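/- All games are short two-player combinatorial games under normal play. A game form $G=\{G^{\mathcal L}\mid G^{\mathcal R}\}$ is built recursively from finitely many Left options and finitely many Right options. The order is given by: $G\leqslant H$ if and only if there is no Left option $G^L$ with $H\leqslant G^L$ and no Right option $H^R$ with $H^R\leqslant G$; and $G=H$ means that $G\leqslant H$ and $H\leqslant G$. The disjunctive sum is $G+H=\{G^{\mathcal L}+H,\ G+H^{\mathcal L}\mid G^{\mathcal R}+H,\ G+H^{\mathcal R}\}$. The canonical form of $G$ is the unique form that is equal to $G$ and has no dominated and no reversible options at any of its positions, and the birthday $b(G)$ is the height of the game tree of the canonical form of $G$. A game $G$ is decomposable if there are games $H$ and $J$ with $b(H)<b(G)$, $b(J)<b(G)$ and $G=H+J$; otherwise $G$ is indecomposable. For a nonnegative integer $k$, the nimber of size $k$ is $*k=\{*0,\ldots,*(k-1)\mid *0,\ldots,*(k-1)\}$. Theorem. Let $k\geqslant 1$ be an integer. Then $*k$ is indecomposable if and only if $k$ is a power of $2$, that is, $k=2^n$ for some integer $n\geqslant 0$. -/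

import Mathlib

/-- Forms of short games: `mk m n L R` is the form `{L 0, …, L (m-1) | R 0, …, R (n-1)}`. -/
inductive GameForm : Type
  | mk (m n : ℕ) (L : Fin m → GameForm) (R : Fin n → GameForm) : GameForm

namespace GameForm

/-- The number of Left options. -/
def leftCard : GameForm → ℕ
  | mk m _ _ _ => m

/-- The number of Right options. -/
def rightCard : GameForm → ℕ
  | mk _ n _ _ => n

/-- The Left options. -/
def left : (G : GameForm) → Fin G.leftCard → GameForm
  | mk _ _ L _ => L

/-- The Right options. -/
def right : (G : GameForm) → Fin G.rightCard → GameForm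
  | mk _ _ _ R => R

/-- The height of the game tree of a form (its formal birthday): `0` for the form `{ | }`, and
otherwise one more than the largest height of an option. -/
def height : GameForm → ℕ
  | mk _ _ L R =>
    max (Finset.univ.sup fun i => height (L i) + 1) (Finset.univ.sup fun j => height (R j) + 1)

theorem height_left_lt (G : GameForm) (i : Fin G.leftCard) : (G.left i).height < G.height := by
  cases G with
  | mk m n L R =>
    have h := Finset.le_sup (f := fun i => height (L i) + 1) (Finset.mem_univ i)
    simp only [height, left]
    exact lt_of_lt_of_le (Nat.lt_succ_self _) (le_trans h (le_max_left _ _))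

theorem height_right_lt (G : GameForm) (j : Fin G.rightCard) :
    (G.right j).height < G.height := by
  cases G with
  | mk m n L R =>
    have h := Finset.le_sup (f := fun j => height (R j) + 1) (Finset.mem_univ j)
    simp only [height, right]
    exact lt_of_lt_of_le (Nat.lt_succ_self _) (le_trans h (le_max_right _ _))

theorem height_le_iff (G : GameForm) (b : ℕ) :
    G.height ≤ b ↔ (∀ i, (G.left i).height < b) ∧ ∀ j, (G.right j).height < b := by
  cases G with
  | mk m n L R =>
    simp only [height, left, right, max_le_iff, Finset.sup_le_iff, Finset.mem_univ, true_implies]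
    rfl

/-- The order on game forms: `G ≤ H` if and only if there is no Left option `Gᴸ` with `H ≤ Gᴸ`
and no Right option `Hᴿ` with `Hᴿ ≤ G`. -/
protected def le (G H : GameForm) : Prop :=
  (∀ i : Fin G.leftCard, ¬ GameForm.le H (G.left i)) ∧
    (∀ j : Fin H.rightCard, ¬ GameForm.le (H.right j) G)
termination_by G.height + H.height
decreasing_by
  · have := height_left_lt G i; omega
  · have := height_right_lt H j; omega

instance : LE GameForm := ⟨GameForm.le⟩

theorem le_iff (G H : GameForm) :
    G ≤ H ↔ (∀ i, ¬ H ≤ G.left i) ∧ (∀ j, ¬ H.right j ≤ G) := by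
  change GameForm.le G H ↔ _
  rw [GameForm.le]
  rfl

/-- Equality of game values, `G = H` in the sense of combinatorial game theory:
`G ≤ H` and `H ≤ G`. -/
def Equal (G H : GameForm) : Prop := G ≤ H ∧ H ≤ G

/-- The disjunctive sum `G + H = {Gᴸ + H, G + Hᴸ | Gᴿ + H, G + Hᴿ}`. -/
protected def add (G H : GameForm) : GameForm :=
  mk (G.leftCard + H.leftCard) (G.rightCard + H.rightCard)
    (Fin.append (fun i => GameForm.add (G.left i) H) (fun i => GameForm.add G (H.left i)))
    (Fin.append (fun j => GameForm.add (G.right j) H) (fun j => GameForm.add G (H.right j)))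
termination_by G.height + H.height
decreasing_by
  · have := height_left_lt G i; omega
  · have := height_left_lt H i; omega
  · have := height_right_lt G j; omega
  · have := height_right_lt H j; omega

instance : Add GameForm := ⟨GameForm.add⟩

theorem add_def (G H : GameForm) :
    G + H = mk (G.leftCard + H.leftCard) (G.rightCard + H.rightCard)
      (Fin.append (fun i => G.left i + H) (fun i => G + H.left i))
      (Fin.append (fun j => G.right j + H) (fun j => G + H.right j)) := by
  change GameForm.add G H = _
  rw [GameForm.add]
  rfl

/-- The nimber `*n = {*0, …, *(n-1) | *0, …, *(n-1)}`. -/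
def nimber (n : ℕ) : GameForm :=
  mk n n (fun i => nimber i.1) (fun i => nimber i.1)
termination_by n
decreasing_by
  · exact i.2
  · exact i.2

/-- A form is canonical if no two distinct Left options are comparable and no two distinct Right
options are comparable (that is, there are no dominated options), no Left option `Gᴸ` has a Right
option `Gᴸᴿ ≤ G` and no Right option `Gᴿ` has a Left option `Gᴿᴸ ≥ G` (that is, there are no
reversible options), and all its options are canonical. -/
def IsCanonical (G : GameForm) : Prop :=
  (∀ i i', i ≠ i' → ¬ G.left i ≤ G.left i') ∧
  (∀ j j', j ≠ j' → ¬ G.right j ≤ G.right j') ∧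
  (∀ i k, ¬ (G.left i).right k ≤ G) ∧
  (∀ j k, ¬ G ≤ (G.right j).left k) ∧
  (∀ i : Fin G.leftCard, IsCanonical (G.left i)) ∧
  (∀ j : Fin G.rightCard, IsCanonical (G.right j))
termination_by G.height
decreasing_by
  · exact height_left_lt G i
  · exact height_right_lt G j

/-! Every form equals a canonical form, and the height of that canonical form is unique. -/

theorem le_refl' (G : GameForm) : G ≤ G := by
  induction hn : G.height using Nat.strong_induction_on generalizing G with
  | _ n ih =>
    subst hn
    refine (le_iff G G).2 ⟨fun i h => ?_, fun j h => ?_⟩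
    · exact ((le_iff _ _).1 h).1 i (ih _ (height_left_lt G i) _ rfl)
    · exact ((le_iff _ _).1 h).2 j (ih _ (height_right_lt G j) _ rfl)

theorem le_trans' (G H K : GameForm) (h₁ : G ≤ H) (h₂ : H ≤ K) : G ≤ K := by
  induction hn : G.height + H.height + K.height using Nat.strong_induction_on
    generalizing G H K with
  | _ n ih =>
    subst hn
    refine (le_iff G K).2 ⟨fun i h => ?_, fun j h => ?_⟩
    · have := height_left_lt G i
      exact ((le_iff _ _).1 h₁).1 i (ih _ (by omega) H K (G.left i) h₂ h rfl)
    · have := height_right_lt K j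
      exact ((le_iff _ _).1 h₂).2 j (ih _ (by omega) (K.right j) G H h h₁ rfl)

theorem not_le_left (G : GameForm) (i : Fin G.leftCard) : ¬ G ≤ G.left i :=
  ((le_iff G G).1 (le_refl' G)).1 i

theorem not_right_le (G : GameForm) (j : Fin G.rightCard) : ¬ G.right j ≤ G :=
  ((le_iff G G).1 (le_refl' G)).2 j

theorem Equal.refl (G : GameForm) : Equal G G := ⟨le_refl' G, le_refl' G⟩

theorem Equal.symm {G H : GameForm} (h : Equal G H) : Equal H G := ⟨h.2, h.1⟩

theorem Equal.trans {G H K : GameForm} (h : Equal G H) (h' : Equal H K) : Equal G K :=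
  ⟨le_trans' _ _ _ h.1 h'.1, le_trans' _ _ _ h'.2 h.2⟩

/-- The number of nodes of the game tree. -/
def nodes : GameForm → ℕ
  | mk _ _ L R => 1 + ∑ i, nodes (L i) + ∑ j, nodes (R j)

theorem nodes_eq (G : GameForm) :
    G.nodes = 1 + ∑ i, (G.left i).nodes + ∑ j, (G.right j).nodes := by
  cases G with
  | mk m n L R => rfl

/-- The form whose Left and Right options are the members of two given lists. -/
def ofLists (l r : List GameForm) : GameForm := mk l.length r.length l.get r.get

theorem nodes_ofLists (l r : List GameForm) :
    (ofLists l r).nodes = 1 + (l.map nodes).sum + (r.map nodes).sum := by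
  have h : ∀ l : List GameForm, ∑ i, nodes (l.get i) = (l.map nodes).sum := fun l => by
    rw [← List.sum_ofFn, List.ofFn_comp' l.get nodes]
    simp
  simp only [ofLists, nodes, h]

theorem forall_left_ofLists (l r : List GameForm) (P : GameForm → Prop) :
    (∀ i, P ((ofLists l r).left i)) ↔ ∀ X ∈ l, P X := by
  simp only [List.forall_mem_iff_get]
  rfl

theorem forall_right_ofLists (l r : List GameForm) (P : GameForm → Prop) :
    (∀ j, P ((ofLists l r).right j)) ↔ ∀ X ∈ r, P X := by
  simp only [List.forall_mem_iff_get]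
  rfl

theorem ofLists_le_iff (l r : List GameForm) (H : GameForm) :
    ofLists l r ≤ H ↔ (∀ X ∈ l, ¬ H ≤ X) ∧ ∀ j, ¬ H.right j ≤ ofLists l r := by
  rw [le_iff, forall_left_ofLists l r (fun X => ¬ H ≤ X)]

theorem le_ofLists_iff (l r : List GameForm) (H : GameForm) :
    H ≤ ofLists l r ↔ (∀ i, ¬ ofLists l r ≤ H.left i) ∧ ∀ X ∈ r, ¬ X ≤ H := by
  rw [le_iff, forall_right_ofLists l r (fun X => ¬ X ≤ H)]

/-- The members of a finite family other than the one with index `i`. -/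
def others {m : ℕ} (L : Fin m → GameForm) (i : Fin m) : List GameForm :=
  ((List.finRange m).erase i).map L

theorem mem_others {m : ℕ} (L : Fin m → GameForm) (i : Fin m) (X : GameForm) :
    X ∈ others L i ↔ ∃ i', i' ≠ i ∧ L i' = X := by
  simp [others, (List.nodup_finRange m).mem_erase_iff]

theorem sum_others {m : ℕ} (L : Fin m → GameForm) (i : Fin m) :
    ((others L i).map nodes).sum + (L i).nodes = ∑ i', (L i').nodes := by
  have h := List.sum_map_erase (fun x => (L x).nodes) (List.mem_finRange i)
  have h2 : ∑ i', (L i').nodes = ((List.finRange m).map fun x => (L x).nodes).sum := by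
    rw [← List.sum_ofFn, List.ofFn_eq_map]
  rw [h2, ← h, others, List.map_map, add_comm]
  rfl

/-- Replace the Left option with index `i` by the members of a list. -/
def replaceLeft (G : GameForm) (i : Fin G.leftCard) (M : List GameForm) : GameForm :=
  ofLists (others G.left i ++ M) (List.ofFn G.right)

/-- Replace the Right option with index `j` by the members of a list. -/
def replaceRight (G : GameForm) (j : Fin G.rightCard) (M : List GameForm) : GameForm :=
  ofLists (List.ofFn G.left) (others G.right j ++ M)

theorem nodes_replaceLeft (G : GameForm) (i : Fin G.leftCard) (M : List GameForm)
    (hM : (M.map nodes).sum < (G.left i).nodes) : (G.replaceLeft i M).nodes < G.nodes := by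
  have h := sum_others G.left i
  rw [replaceLeft, nodes_ofLists, nodes_eq G, List.map_append, List.sum_append, List.map_ofFn,
    List.sum_ofFn]
  simp only [Function.comp_apply]
  omega

theorem nodes_replaceRight (G : GameForm) (j : Fin G.rightCard) (M : List GameForm)
    (hM : (M.map nodes).sum < (G.right j).nodes) : (G.replaceRight j M).nodes < G.nodes := by
  have h := sum_others G.right j
  rw [replaceRight, nodes_ofLists, nodes_eq G, List.map_append, List.sum_append, List.map_ofFn,
    List.sum_ofFn]
  simp only [Function.comp_apply]
  omega

theorem replaceLeft_equal (G : GameForm) (i : Fin G.leftCard) (M : List GameForm)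
    (h₁ : ∀ X ∈ M, ¬ G ≤ X)
    (h₂ : (∀ X ∈ others G.left i ++ M, ¬ G.replaceLeft i M ≤ X) →
      (∀ j, ¬ G.right j ≤ G.replaceLeft i M) → ¬ G.replaceLeft i M ≤ G.left i) :
    Equal (G.replaceLeft i M) G := by
  have hs := le_refl' (G.replaceLeft i M)
  have hl := ((ofLists_le_iff _ _ _).1 hs).1
  have hr : ∀ j, ¬ G.right j ≤ G.replaceLeft i M := fun j =>
    ((le_ofLists_iff _ _ _).1 hs).2 _ (by simp)
  constructor
  · refine (ofLists_le_iff _ _ _).2 ⟨fun X hX => ?_, hr⟩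
    rcases List.mem_append.1 hX with hX | hX
    · obtain ⟨i', -, rfl⟩ := (mem_others _ _ _).1 hX
      exact not_le_left G i'
    · exact h₁ X hX
  · refine (le_ofLists_iff _ _ _).2 ⟨fun i' => ?_, fun X hX => ?_⟩
    · by_cases h : i' = i
      · subst h
        exact h₂ hl hr
      · exact hl _ (List.mem_append_left _ ((mem_others _ _ _).2 ⟨i', h, rfl⟩))
    · obtain ⟨j, rfl⟩ := (List.mem_ofFn' _ _).1 hX
      exact not_right_le G j

theorem replaceRight_equal (G : GameForm) (j : Fin G.rightCard) (M : List GameForm)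
    (h₁ : ∀ X ∈ M, ¬ X ≤ G)
    (h₂ : (∀ X ∈ others G.right j ++ M, ¬ X ≤ G.replaceRight j M) →
      (∀ i, ¬ G.replaceRight j M ≤ G.left i) → ¬ G.right j ≤ G.replaceRight j M) :
    Equal (G.replaceRight j M) G := by
  have hs := le_refl' (G.replaceRight j M)
  have hr := ((le_ofLists_iff _ _ _).1 hs).2
  have hl : ∀ i, ¬ G.replaceRight j M ≤ G.left i := fun i =>
    ((ofLists_le_iff _ _ _).1 hs).1 _ (by simp)
  constructor
  · refine (ofLists_le_iff _ _ _).2 ⟨fun X hX => ?_, fun j' => ?_⟩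
    · obtain ⟨i, rfl⟩ := (List.mem_ofFn' _ _).1 hX
      exact not_le_left G i
    · by_cases h : j' = j
      · subst h
        exact h₂ hr hl
      · exact hr _ (List.mem_append_left _ ((mem_others _ _ _).2 ⟨j', h, rfl⟩))
  · refine (le_ofLists_iff _ _ _).2 ⟨hl, fun X hX => ?_⟩
    rcases List.mem_append.1 hX with hX | hX
    · obtain ⟨j', -, rfl⟩ := (mem_others _ _ _).1 hX
      exact not_right_le G j'
    · exact h₁ X hX

theorem nodes_pos (G : GameForm) : 0 < G.nodes := by
  rw [nodes_eq]; omega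

/-- A form with the fewest nodes among the forms of its value is canonical. -/
theorem isCanonical_of_minimal (G : GameForm) (hG : ∀ K, Equal K G → G.nodes ≤ K.nodes) :
    IsCanonical G := by
  induction hn : G.height using Nat.strong_induction_on generalizing G with
  | _ n ih =>
    subst hn
    rw [IsCanonical]
    refine ⟨fun i i' hi h => ?_, fun j j' hj h => ?_, fun i k h => ?_, fun j k h => ?_,
      fun i => ?_, fun j => ?_⟩
    · refine absurd (hG _ (replaceLeft_equal G i [] (by simp) fun hl _ h' => ?_))
        (not_le.2 (nodes_replaceLeft G i [] (by simpa using nodes_pos _)))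
      exact hl _ (List.mem_append_left _ ((mem_others _ _ _).2 ⟨i', hi.symm, rfl⟩))
        (le_trans' _ _ _ h' h)
    · refine absurd (hG _ (replaceRight_equal G j' [] (by simp) fun hr _ h' => ?_))
        (not_le.2 (nodes_replaceRight G j' [] (by simpa using nodes_pos _)))
      exact hr _ (List.mem_append_left _ ((mem_others _ _ _).2 ⟨j, hj, rfl⟩))
        (le_trans' _ _ _ h h')
    · refine absurd (hG _ (replaceLeft_equal G i (List.ofFn ((G.left i).right k).left)
        (fun X hX h' => ?_) fun hl hr h' => ?_))
        (not_le.2 (nodes_replaceLeft G i _ ?_))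
      · obtain ⟨a, rfl⟩ := (List.mem_ofFn' _ _).1 hX
        exact not_le_left _ a (le_trans' _ _ _ h h')
      · refine ((le_iff _ _).1 h').2 k ((le_iff _ _).2 ⟨fun a => ?_, fun b hb => ?_⟩)
        · exact hl _ (List.mem_append_right _ (by simp))
        · obtain ⟨j, hj⟩ := (List.mem_ofFn' _ _).1 (List.get_mem (List.ofFn G.right) b)
          refine ((le_iff _ _).1 h).2 j ?_
          rw [hj]
          exact hb
      · rw [List.map_ofFn, List.sum_ofFn, nodes_eq (G.left i)]
        have h1 := nodes_eq ((G.left i).right k)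
        have h2 := Finset.single_le_sum (f := fun k => ((G.left i).right k).nodes)
          (fun _ _ => Nat.zero_le _) (Finset.mem_univ k)
        simp only [Function.comp_apply] at *
        omega
    · refine absurd (hG _ (replaceRight_equal G j (List.ofFn ((G.right j).left k).right)
        (fun X hX h' => ?_) fun hr hl h' => ?_))
        (not_le.2 (nodes_replaceRight G j _ ?_))
      · obtain ⟨a, rfl⟩ := (List.mem_ofFn' _ _).1 hX
        exact not_right_le _ a (le_trans' _ _ _ h' h)
      · refine ((le_iff _ _).1 h').1 k ((le_iff _ _).2 ⟨fun b hb => ?_, fun a => ?_⟩)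
        · obtain ⟨i, hi⟩ := (List.mem_ofFn' _ _).1 (List.get_mem (List.ofFn G.left) b)
          refine ((le_iff _ _).1 h).1 i ?_
          rw [hi]
          exact hb
        · exact hr _ (List.mem_append_right _ (by simp))
      · rw [List.map_ofFn, List.sum_ofFn, nodes_eq (G.right j)]
        have h1 := nodes_eq ((G.right j).left k)
        have h2 := Finset.single_le_sum (f := fun k => ((G.right j).left k).nodes)
          (fun _ _ => Nat.zero_le _) (Finset.mem_univ k)
        simp only [Function.comp_apply] at *
        omega
    · refine ih _ (height_left_lt G i) _ (fun K hK => ?_) rfl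
      by_contra hlt
      refine absurd (hG _ (replaceLeft_equal G i [K] (fun X hX h' => ?_) fun hl _ h' => ?_))
        (not_le.2 (nodes_replaceLeft G i [K] (by simpa using hlt)))
      · rw [List.mem_singleton.1 hX] at h'
        exact not_le_left G i (le_trans' _ _ _ h' hK.1)
      · exact hl K (by simp) (le_trans' _ _ _ h' hK.2)
    · refine ih _ (height_right_lt G j) _ (fun K hK => ?_) rfl
      by_contra hlt
      refine absurd (hG _ (replaceRight_equal G j [K] (fun X hX h' => ?_) fun hr _ h' => ?_))
        (not_le.2 (nodes_replaceRight G j [K] (by simpa using hlt)))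
      · rw [List.mem_singleton.1 hX] at h'
        exact not_right_le G j (le_trans' _ _ _ hK.2 h')
      · exact hr K (by simp) (le_trans' _ _ _ hK.1 h')

theorem exists_canonical (G : GameForm) : ∃ K, IsCanonical K ∧ Equal K G := by
  obtain ⟨K, hK, hmin⟩ := WellFounded.has_min (measure nodes).wf {K | Equal K G}
    ⟨G, Equal.refl G⟩
  exact ⟨K, isCanonical_of_minimal K fun K' hK' => not_lt.1 (hmin K' (hK'.trans hK)), hK⟩

theorem IsCanonical.height_le {G H : GameForm} (hG : IsCanonical G) (hH : IsCanonical H)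
    (h : Equal G H) : G.height ≤ H.height := by
  induction hn : G.height + H.height using Nat.strong_induction_on generalizing G H with
  | _ n ih =>
    subst hn
    rw [IsCanonical] at hG hH
    obtain ⟨gl, gr, grl, grr, gcl, gcr⟩ := hG
    obtain ⟨hl, hr, hrl, hrr, hcl, hcr⟩ := hH
    refine (height_le_iff _ _).2 ⟨fun i => ?_, fun j => ?_⟩
    · have h1 := ((le_iff _ _).1 h.1).1 i
      rw [le_iff, not_and_or] at h1
      push Not at h1
      rcases h1 with ⟨i', h1⟩ | ⟨k, h1⟩
      · have h2 := ((le_iff _ _).1 h.2).1 i'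
        rw [le_iff, not_and_or] at h2
        push Not at h2
        rcases h2 with ⟨a, h2⟩ | ⟨k, h2⟩
        · have hia : i = a := by
            by_contra hne
            exact gl i a hne (le_trans' _ _ _ h1 h2)
          subst hia
          have a1 := height_left_lt G i
          have a2 := height_left_lt H i'
          have := ih _ (by omega) (gcl i) (hcl i') ⟨h1, h2⟩ rfl
          omega
        · exact absurd (le_trans' _ _ _ h2 h.1) (hrl i' k)
      · exact absurd (le_trans' _ _ _ h1 h.2) (grl i k)
    · have h1 := ((le_iff _ _).1 h.2).2 j
      rw [le_iff, not_and_or] at h1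
      push Not at h1
      rcases h1 with ⟨k, h1⟩ | ⟨j', h1⟩
      · exact absurd (le_trans' _ _ _ h.1 h1) (grr j k)
      · have h2 := ((le_iff _ _).1 h.1).2 j'
        rw [le_iff, not_and_or] at h2
        push Not at h2
        rcases h2 with ⟨k, h2⟩ | ⟨a, h2⟩
        · exact absurd (le_trans' _ _ _ h.2 h2) (hrr j' k)
        · have hja : a = j := by
            by_contra hne
            exact gr a j hne (le_trans' _ _ _ h2 h1)
          subst hja
          have a1 := height_right_lt G a
          have a2 := height_right_lt H j'
          have := ih _ (by omega) (gcr a) (hcr j') ⟨h2, h1⟩ rfl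
          omega

/-- A canonical form of the value of `G`. -/
noncomputable def canonicalForm (G : GameForm) : GameForm := (exists_canonical G).choose

theorem canonicalForm_spec (G : GameForm) :
    IsCanonical G.canonicalForm ∧ Equal G.canonicalForm G := (exists_canonical G).choose_spec

/-- The birthday `b(G)`: the height of the game tree of the canonical form of `G`. -/
noncomputable def birthday (G : GameForm) : ℕ := G.canonicalForm.height

theorem birthday_eq (G K : GameForm) (hK : IsCanonical K) (h : Equal K G) :
    G.birthday = K.height :=
  le_antisymm
    ((canonicalForm_spec G).1.height_le hK ((canonicalForm_spec G).2.trans h.symm))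
    (hK.height_le (canonicalForm_spec G).1 (h.trans (canonicalForm_spec G).2.symm))

/-- `G` is decomposable if `G = H + J` for some `H`, `J` with `b(H) < b(G)` and `b(J) < b(G)`. -/
def Decomposable (G : GameForm) : Prop :=
  ∃ H J : GameForm, H.birthday < G.birthday ∧ J.birthday < G.birthday ∧ Equal G (H + J)

/-- `G` is indecomposable if it is not decomposable. -/
def Indecomposable (G : GameForm) : Prop := ¬ Decomposable G

end GameForm

namespace GameForm

/-! Modulo equality, games form a partially ordered abelian group in which distinct nimbers are
incomparable and nimbers add by binary xor (`star_add_star`). If `k` is not a power of 2, splitting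
off its leading binary digit writes `*k` as a sum of two smaller nimbers.

For `k = 2^n`, a decomposition `H + J` yields `X = Y + *2^n` with `X`, `Y` the canonical forms of
`H` and `-J`, both of height below `2^n`. `noFarTranslate` excludes this, and does so for every far
nimber `*k`, meaning `2^n ≤ k < 2^(n+1)`. The induction is on the weight `2^height X + 2^height Y`.
Below the weight of a minimal counterexample, all far nimbers are interchangeable in inequalities `X
+ *k ≤ Y` (`NoFarTranslate.add_star_le`). In a minimal counterexample this forces `k = 2^n`. With
`X` no taller than `Y`, it also forces, for each of the `2^n` far values `k'`, a right option of `Y`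
equal to `Y + *k'`. These options have pairwise distinct heights (`NoFarTranslate.height_right_ne`),
all below `height Y < 2^n`, which contradicts the pigeonhole principle.

The weight is exponential so that two proper subpositions of `Y` together weigh at most `2^height
Y`. They can then be compared with each other however small `X` is. -/

/-! ### Order and disjunctive sum -/

theorem forall_left_add (G H : GameForm) (P : GameForm → Prop) :
    (∀ i, P ((G + H).left i)) ↔ (∀ i, P (G.left i + H)) ∧ ∀ i, P (G + H.left i) := by
  rw [add_def]
  constructor
  · intro h
    exact ⟨fun i => by simpa [left] using h (Fin.castAdd _ i),
      fun i => by simpa [left] using h (Fin.natAdd _ i)⟩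
  · rintro ⟨h₁, h₂⟩ i
    refine Fin.addCases (fun i => ?_) (fun i => ?_) i
    · simpa [left] using h₁ i
    · simpa [left] using h₂ i

theorem forall_right_add (G H : GameForm) (P : GameForm → Prop) :
    (∀ j, P ((G + H).right j)) ↔ (∀ j, P (G.right j + H)) ∧ ∀ j, P (G + H.right j) := by
  rw [add_def]
  constructor
  · intro h
    exact ⟨fun i => by simpa [right] using h (Fin.castAdd _ i),
      fun i => by simpa [right] using h (Fin.natAdd _ i)⟩
  · rintro ⟨h₁, h₂⟩ i
    refine Fin.addCases (fun i => ?_) (fun i => ?_) i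
    · simpa [right] using h₁ i
    · simpa [right] using h₂ i

theorem not_add_le_left_add (G H : GameForm) (i : Fin G.leftCard) : ¬ G + H ≤ G.left i + H :=
  ((forall_left_add G H fun X => ¬ G + H ≤ X).1 (not_le_left (G + H))).1 i

theorem not_add_le_add_left (G H : GameForm) (i : Fin H.leftCard) : ¬ G + H ≤ G + H.left i :=
  ((forall_left_add G H fun X => ¬ G + H ≤ X).1 (not_le_left (G + H))).2 i

theorem not_right_add_le_add (G H : GameForm) (j : Fin G.rightCard) : ¬ G.right j + H ≤ G + H :=
  ((forall_right_add G H fun X => ¬ X ≤ G + H).1 (not_right_le (G + H))).1 j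

theorem not_add_right_le_add (G H : GameForm) (j : Fin H.rightCard) : ¬ G + H.right j ≤ G + H :=
  ((forall_right_add G H fun X => ¬ X ≤ G + H).1 (not_right_le (G + H))).2 j

theorem add_le_add_comm (G H : GameForm) : G + H ≤ H + G := by
  induction hn : G.height + H.height using Nat.strong_induction_on generalizing G H with
  | _ n ih =>
    subst hn
    rw [le_iff, forall_left_add G H fun X => ¬ H + G ≤ X,
      forall_right_add H G fun X => ¬ X ≤ G + H]
    refine ⟨⟨fun i h => ?_, fun i h => ?_⟩, fun j h => ?_, fun j h => ?_⟩
    · have := height_left_lt G i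
      exact not_add_le_add_left H G i (le_trans' _ _ _ h (ih _ (by omega) _ _ rfl))
    · have := height_left_lt H i
      exact not_add_le_left_add H G i (le_trans' _ _ _ h (ih _ (by omega) _ _ rfl))
    · have := height_right_lt H j
      exact not_add_right_le_add G H j (le_trans' _ _ _ (ih _ (by omega) _ _ rfl) h)
    · have := height_right_lt G j
      exact not_right_add_le_add G H j (le_trans' _ _ _ (ih _ (by omega) _ _ rfl) h)

/-- A bad option of `G` gives `¬ H ≤ G.left i`, hence a left option of `H` above `G.left i` or a
right option of `G.left i` below `H`. Induction adds `K` to that inequality, and a sum is never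
below its own left option nor above its own right option. -/
theorem add_le_add_right' (G H K : GameForm) (h : G ≤ H) : G + K ≤ H + K := by
  induction hn : G.height + H.height + K.height using Nat.strong_induction_on
    generalizing G H K with
  | _ n ih =>
    subst hn
    rw [le_iff, forall_left_add G K fun X => ¬ H + K ≤ X,
      forall_right_add H K fun X => ¬ X ≤ G + K]
    refine ⟨⟨fun i h' => ?_, fun i h' => ?_⟩, fun j h' => ?_, fun j h' => ?_⟩
    · have := height_left_lt G i
      have h1 := ((le_iff _ _).1 h).1 i
      rw [le_iff, not_and_or] at h1
      push Not at h1
      rcases h1 with ⟨a, h1⟩ | ⟨b, h1⟩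
      · have := height_left_lt H a
        exact not_add_le_left_add H K a (le_trans' _ _ _ h' (ih _ (by omega) _ _ K h1 rfl))
      · have := height_right_lt (G.left i) b
        exact not_right_add_le_add (G.left i) K b
          (le_trans' _ _ _ (ih _ (by omega) _ _ K h1 rfl) h')
    · have := height_left_lt K i
      exact not_add_le_add_left H K i (le_trans' _ _ _ h' (ih _ (by omega) _ _ _ h rfl))
    · have := height_right_lt H j
      have h1 := ((le_iff _ _).1 h).2 j
      rw [le_iff, not_and_or] at h1
      push Not at h1
      rcases h1 with ⟨a, h1⟩ | ⟨b, h1⟩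
      · have := height_left_lt (H.right j) a
        exact not_add_le_left_add (H.right j) K a
          (le_trans' _ _ _ h' (ih _ (by omega) _ _ K h1 rfl))
      · have := height_right_lt G b
        exact not_right_add_le_add G K b (le_trans' _ _ _ (ih _ (by omega) _ _ K h1 rfl) h')
    · have := height_right_lt K j
      exact not_add_right_le_add G K j (le_trans' _ _ _ (ih _ (by omega) _ _ _ h rfl) h')

theorem add_assoc_equal (G H K : GameForm) : Equal (G + H + K) (G + (H + K)) := by
  induction hn : G.height + H.height + K.height using Nat.strong_induction_on
    generalizing G H K with
  | _ n ih =>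
    subst hn
    have lG : ∀ i, Equal (G.left i + H + K) (G.left i + (H + K)) := fun i =>
      ih _ (by have := height_left_lt G i; omega) _ _ _ rfl
    have lH : ∀ i, Equal (G + H.left i + K) (G + (H.left i + K)) := fun i =>
      ih _ (by have := height_left_lt H i; omega) _ _ _ rfl
    have lK : ∀ i, Equal (G + H + K.left i) (G + (H + K.left i)) := fun i =>
      ih _ (by have := height_left_lt K i; omega) _ _ _ rfl
    have rG : ∀ i, Equal (G.right i + H + K) (G.right i + (H + K)) := fun i =>
      ih _ (by have := height_right_lt G i; omega) _ _ _ rfl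
    have rH : ∀ i, Equal (G + H.right i + K) (G + (H.right i + K)) := fun i =>
      ih _ (by have := height_right_lt H i; omega) _ _ _ rfl
    have rK : ∀ i, Equal (G + H + K.right i) (G + (H + K.right i)) := fun i =>
      ih _ (by have := height_right_lt K i; omega) _ _ _ rfl
    have a1 := (forall_left_add _ _ fun X => ¬ G + H + K ≤ X).1 (not_le_left (G + H + K))
    rw [forall_left_add G H fun X => ¬ G + H + K ≤ X + K] at a1
    have a2 := (forall_right_add _ _ fun X => ¬ X ≤ G + H + K).1 (not_right_le (G + H + K))
    rw [forall_right_add G H fun X => ¬ X + K ≤ G + H + K] at a2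
    have b1 := (forall_left_add _ _ fun X => ¬ G + (H + K) ≤ X).1 (not_le_left (G + (H + K)))
    rw [forall_left_add H K fun X => ¬ G + (H + K) ≤ G + X] at b1
    have b2 := (forall_right_add _ _ fun X => ¬ X ≤ G + (H + K)).1 (not_right_le (G + (H + K)))
    rw [forall_right_add H K fun X => ¬ G + X ≤ G + (H + K)] at b2
    obtain ⟨⟨aG, aH⟩, aK⟩ := a1
    obtain ⟨⟨aG', aH'⟩, aK'⟩ := a2
    obtain ⟨bG, bH, bK⟩ := b1
    obtain ⟨bG', bH', bK'⟩ := b2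
    constructor
    · rw [le_iff, forall_left_add _ _ fun X => ¬ G + (H + K) ≤ X,
        forall_left_add G H fun X => ¬ G + (H + K) ≤ X + K,
        forall_right_add _ _ fun X => ¬ X ≤ G + H + K,
        forall_right_add H K fun X => ¬ G + X ≤ G + H + K]
      exact ⟨⟨⟨fun i h => bG i (le_trans' _ _ _ h (lG i).1),
        fun i h => bH i (le_trans' _ _ _ h (lH i).1)⟩,
        fun i h => bK i (le_trans' _ _ _ h (lK i).1)⟩,
        fun i h => aG' i (le_trans' _ _ _ (rG i).1 h),
        fun i h => aH' i (le_trans' _ _ _ (rH i).1 h),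
        fun i h => aK' i (le_trans' _ _ _ (rK i).1 h)⟩
    · rw [le_iff, forall_left_add _ _ fun X => ¬ G + H + K ≤ X,
        forall_left_add H K fun X => ¬ G + H + K ≤ G + X,
        forall_right_add _ _ fun X => ¬ X ≤ G + (H + K),
        forall_right_add G H fun X => ¬ X + K ≤ G + (H + K)]
      exact ⟨⟨fun i h => aG i (le_trans' _ _ _ h (lG i).2),
        fun i h => aH i (le_trans' _ _ _ h (lH i).2),
        fun i h => aK i (le_trans' _ _ _ h (lK i).2)⟩,
        ⟨fun i h => bG' i (le_trans' _ _ _ (rG i).2 h),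
        fun i h => bH' i (le_trans' _ _ _ (rH i).2 h)⟩,
        fun i h => bK' i (le_trans' _ _ _ (rK i).2 h)⟩

/-! ### Zero and negatives -/

/-- The empty form `{ | }`. -/
instance : Zero GameForm := ⟨mk 0 0 Fin.elim0 Fin.elim0⟩

theorem zero_le_iff (G : GameForm) : 0 ≤ G ↔ ∀ j, ¬ G.right j ≤ 0 := by
  rw [le_iff]
  exact ⟨fun h => h.2, fun h => ⟨fun i => i.elim0, h⟩⟩

theorem le_zero_iff (G : GameForm) : G ≤ 0 ↔ ∀ i, ¬ 0 ≤ G.left i := by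
  rw [le_iff]
  exact ⟨fun h => h.1, fun h => ⟨h, fun i => i.elim0⟩⟩

theorem zero_add_equal (G : GameForm) : Equal (0 + G) G := by
  induction hn : G.height using Nat.strong_induction_on generalizing G with
  | _ n ih =>
    subst hn
    have hl := fun i => ih _ (height_left_lt G i) _ rfl
    have hr := fun j => ih _ (height_right_lt G j) _ rfl
    constructor
    · rw [le_iff, forall_left_add _ _ fun X => ¬ G ≤ X]
      exact ⟨⟨fun i => i.elim0, fun i h => not_le_left G i (le_trans' _ _ _ h (hl i).1)⟩,
        fun j h => not_add_right_le_add 0 G j (le_trans' _ _ _ (hr j).1 h)⟩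
    · rw [le_iff, forall_right_add _ _ fun X => ¬ X ≤ G]
      exact ⟨fun i h => not_add_le_add_left 0 G i (le_trans' _ _ _ h (hl i).2),
        fun i => i.elim0, fun j h => not_right_le G j (le_trans' _ _ _ (hr j).2 h)⟩

/-- The negative of a form: the roles of the players are exchanged. -/
protected def neg : GameForm → GameForm
  | mk m n L R => mk n m (fun j => GameForm.neg (R j)) (fun i => GameForm.neg (L i))

instance : Neg GameForm := ⟨GameForm.neg⟩

theorem forall_left_neg (G : GameForm) (P : GameForm → Prop) :
    (∀ i, P ((-G).left i)) ↔ ∀ j, P (-G.right j) := by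
  cases G
  rfl

theorem forall_right_neg (G : GameForm) (P : GameForm → Prop) :
    (∀ j, P ((-G).right j)) ↔ ∀ i, P (-G.left i) := by
  cases G
  rfl

/-- The mirror strategy: any move in one summand is answered by its negative in the other. -/
theorem add_neg_equal_zero (G : GameForm) : Equal (G + -G) 0 := by
  induction hn : G.height using Nat.strong_induction_on generalizing G with
  | _ n ih =>
    subst hn
    constructor
    · rw [le_zero_iff, forall_left_add _ _ fun X => ¬ 0 ≤ X,
        forall_left_neg G fun X => ¬ 0 ≤ G + X]
      refine ⟨fun i h => ?_, fun j h => ?_⟩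
      · have h1 := (zero_le_iff _).1 h
        rw [forall_right_add _ _ fun X => ¬ X ≤ 0,
          forall_right_neg G fun X => ¬ G.left i + X ≤ 0] at h1
        exact h1.2 i (ih _ (height_left_lt G i) _ rfl).1
      · have h1 := (zero_le_iff _).1 h
        rw [forall_right_add _ _ fun X => ¬ X ≤ 0] at h1
        exact h1.1 j (ih _ (height_right_lt G j) _ rfl).1
    · rw [zero_le_iff, forall_right_add _ _ fun X => ¬ X ≤ 0,
        forall_right_neg G fun X => ¬ G + X ≤ 0]
      refine ⟨fun j h => ?_, fun i h => ?_⟩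
      · have h1 := (le_zero_iff _).1 h
        rw [forall_left_add _ _ fun X => ¬ 0 ≤ X,
          forall_left_neg G fun X => ¬ 0 ≤ G.right j + X] at h1
        exact h1.2 j (ih _ (height_right_lt G j) _ rfl).2
      · have h1 := (le_zero_iff _).1 h
        rw [forall_left_add _ _ fun X => ¬ 0 ≤ X] at h1
        exact h1.1 i (ih _ (height_left_lt G i) _ rfl).2

theorem Equal.add {G G' H H' : GameForm} (h : Equal G G') (h' : Equal H H') :
    Equal (G + H) (G' + H') := by
  have key : ∀ {A A' B B' : GameForm}, A ≤ A' → B ≤ B' → A + B ≤ A' + B' := fun {A A' B B'} h h' =>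
    le_trans' _ _ _ (add_le_add_right' A A' B h) (le_trans' _ _ _ (add_le_add_comm A' B)
      (le_trans' _ _ _ (add_le_add_right' B B' A' h') (add_le_add_comm B' A')))
  exact ⟨key h.1 h'.1, key h.2 h'.2⟩

/-- Additive inverses are unique up to equality, so no induction on the forms is needed. -/
theorem Equal.neg {G H : GameForm} (h : Equal G H) : Equal (-G) (-H) := by
  have key : ∀ A B C : GameForm, Equal (A + B) 0 → Equal (A + C) 0 → Equal B C := by
    intro A B C hB hC
    have h1 : Equal B (A + C + B) := (zero_add_equal B).symm.trans (hC.symm.add (Equal.refl B))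
    have h2 : Equal (A + C + B) (C + A + B) :=
      Equal.add ⟨add_le_add_comm A C, add_le_add_comm C A⟩ (Equal.refl B)
    have h3 : Equal (C + (A + B)) (0 + C) :=
      ((Equal.refl C).add hB).trans ⟨add_le_add_comm _ _, add_le_add_comm _ _⟩
    exact h1.trans (h2.trans ((add_assoc_equal C A B).trans (h3.trans (zero_add_equal C))))
  exact key G _ _ (add_neg_equal_zero G) ((h.add (Equal.refl _)).trans (add_neg_equal_zero H))

/-! ### The ordered group of values -/

/-- Equality of game values as a setoid. -/
instance valueSetoid : Setoid GameForm := ⟨Equal, Equal.refl, Equal.symm, Equal.trans⟩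

/-- Game values: forms up to equality. -/
def Value : Type := Quotient valueSetoid

/-- The value of a form. -/
def val (G : GameForm) : Value := Quotient.mk _ G

theorem val_eq_iff (G H : GameForm) : val G = val H ↔ Equal G H := Quotient.eq

namespace Value

instance : Zero Value := ⟨val 0⟩
instance : Add Value :=
  ⟨Quotient.map₂ (· + ·) fun _ _ h _ _ h' => Equal.add h h'⟩
instance : Neg Value := ⟨Quotient.map (- ·) fun _ _ h => Equal.neg h⟩

instance : PartialOrder Value where
  le := Quotient.lift₂ (· ≤ ·) fun _ _ _ _ h h' => propext
    ⟨fun k => le_trans' _ _ _ h.2 (le_trans' _ _ _ k h'.1),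
      fun k => le_trans' _ _ _ h.1 (le_trans' _ _ _ k h'.2)⟩
  le_refl := by rintro ⟨x⟩; exact le_refl' x
  le_trans := by rintro ⟨x⟩ ⟨y⟩ ⟨z⟩; exact le_trans' x y z
  le_antisymm := by rintro ⟨x⟩ ⟨y⟩ h h'; exact Quotient.sound ⟨h, h'⟩

instance : AddCommGroup Value where
  add_assoc := by rintro ⟨x⟩ ⟨y⟩ ⟨z⟩; exact Quotient.sound (add_assoc_equal x y z)
  zero_add := by rintro ⟨x⟩; exact Quotient.sound (zero_add_equal x)
  add_zero := by
    rintro ⟨x⟩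
    exact Quotient.sound
      (Equal.trans ⟨add_le_add_comm x 0, add_le_add_comm 0 x⟩ (zero_add_equal x))
  neg_add_cancel := by
    rintro ⟨x⟩
    exact Quotient.sound
      (Equal.trans ⟨add_le_add_comm (-x) x, add_le_add_comm x (-x)⟩ (add_neg_equal_zero x))
  add_comm := by
    rintro ⟨x⟩ ⟨y⟩
    exact Quotient.sound ⟨add_le_add_comm x y, add_le_add_comm y x⟩
  nsmul := nsmulRec
  zsmul := zsmulRec

instance : IsOrderedAddMonoid Value where
  add_le_add_left := by
    rintro ⟨x⟩ ⟨y⟩ h ⟨z⟩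
    exact add_le_add_right' x y z h

end Value

theorem val_le_iff (G H : GameForm) : val G ≤ val H ↔ G ≤ H := Iff.rfl

theorem val_add (G H : GameForm) : val (G + H) = val G + val H := rfl

theorem not_val_le_left (G : GameForm) (i : Fin G.leftCard) : ¬ val G ≤ val (G.left i) :=
  not_le_left G i

theorem not_val_right_le (G : GameForm) (j : Fin G.rightCard) : ¬ val (G.right j) ≤ val G :=
  not_right_le G j

/-! ### Nimbers -/

theorem forall_left_nimber (n : ℕ) (P : GameForm → Prop) :
    (∀ i, P ((nimber n).left i)) ↔ ∀ m < n, P (nimber m) := by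
  rw [nimber]
  exact ⟨fun h m hm => h ⟨m, hm⟩, fun h i => h i.1 i.2⟩

theorem forall_right_nimber (n : ℕ) (P : GameForm → Prop) :
    (∀ j, P ((nimber n).right j)) ↔ ∀ m < n, P (nimber m) := by
  rw [nimber]
  exact ⟨fun h m hm => h ⟨m, hm⟩, fun h i => h i.1 i.2⟩

theorem height_nimber (n : ℕ) : (nimber n).height = n := by
  induction n using Nat.strong_induction_on with
  | _ n ih =>
    refine eq_of_forall_ge_iff fun b => ?_
    rw [height_le_iff, forall_left_nimber n fun X => X.height < b,
      forall_right_nimber n fun X => X.height < b, and_self]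
    constructor
    · intro h
      cases n with
      | zero => exact Nat.zero_le _
      | succ n => have := h n (Nat.lt_succ_self n); rw [ih n (Nat.lt_succ_self n)] at this; omega
    · intro h m hm
      rw [ih m hm]
      omega

/-- The value of the nimber `*n`. -/
def star (n : ℕ) : Value := val (nimber n)

theorem star_le_star_iff {a b : ℕ} : star a ≤ star b ↔ a = b := by
  refine ⟨fun h => ?_, fun h => h ▸ le_rfl⟩
  rcases lt_trichotomy a b with hlt | rfl | hlt
  · exact absurd h ((forall_right_nimber b fun X => ¬ val X ≤ val (nimber b)).1
      (not_val_right_le _) a hlt)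
  · rfl
  · exact absurd h ((forall_left_nimber a fun X => ¬ val (nimber a) ≤ val X).1
      (not_val_le_left _) b hlt)

theorem star_zero : star 0 = 0 := by
  refine (val_eq_iff _ _).2 ⟨(le_zero_iff _).2 ?_, (zero_le_iff _).2 ?_⟩
  · rw [forall_left_nimber 0 fun X => ¬ 0 ≤ X]
    exact fun m hm => absurd hm (Nat.not_lt_zero m)
  · rw [forall_right_nimber 0 fun X => ¬ X ≤ 0]
    exact fun m hm => absurd hm (Nat.not_lt_zero m)

theorem val_add_star_le_iff (Y X : GameForm) (k : ℕ) : val Y + star k ≤ val X ↔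
    (∀ i, ¬ val X ≤ val (Y.left i) + star k) ∧ (∀ m < k, ¬ val X ≤ val Y + star m) ∧
      ∀ j, ¬ val (X.right j) ≤ val Y + star k := by
  rw [star, ← val_add, val_le_iff, le_iff, forall_left_add _ _ fun Z => ¬ X ≤ Z,
    forall_left_nimber k fun Z => ¬ X ≤ Y + Z, and_assoc]
  rfl

theorem val_le_add_star_iff (X Y : GameForm) (k : ℕ) : val X ≤ val Y + star k ↔
    (∀ i, ¬ val Y + star k ≤ val (X.left i)) ∧ (∀ j, ¬ val (Y.right j) + star k ≤ val X) ∧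
      ∀ m < k, ¬ val Y + star m ≤ val X := by
  rw [star, ← val_add, val_le_iff, le_iff, forall_right_add _ _ fun Z => ¬ Z ≤ X,
    forall_right_nimber k fun Z => ¬ Y + Z ≤ X]
  rfl

/-- By induction, moving in one summand never yields `*(a ^^^ b)` but reaches every smaller nimber;
any further options reached do not affect the value. -/
theorem star_add_star (a b : ℕ) : star a + star b = star (a ^^^ b) := by
  induction hn : a + b using Nat.strong_induction_on generalizing a b with
  | _ n ih =>
    subst hn
    have ha : ∀ m < a, star m + star b = star (m ^^^ b) := fun m hm => ih _ (by omega) _ _ rfl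
    have hb : ∀ m < b, star a + star m = star (a ^^^ m) := fun m hm => ih _ (by omega) _ _ rfl
    have hl := (forall_left_add _ _ fun X => ¬ nimber a + nimber b ≤ X).1 (not_le_left _)
    rw [forall_left_nimber a fun X => ¬ nimber a + nimber b ≤ X + nimber b,
      forall_left_nimber b fun X => ¬ nimber a + nimber b ≤ nimber a + X] at hl
    have hr := (forall_right_add _ _ fun X => ¬ X ≤ nimber a + nimber b).1 (not_right_le _)
    rw [forall_right_nimber a fun X => ¬ X + nimber b ≤ nimber a + nimber b,
      forall_right_nimber b fun X => ¬ nimber a + X ≤ nimber a + nimber b] at hr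
    simp only [← val_le_iff, val_add] at hl hr
    change (∀ m < a, ¬ star a + star b ≤ star m + star b) ∧
      (∀ m < b, ¬ star a + star b ≤ star a + star m) at hl
    change (∀ m < a, ¬ star m + star b ≤ star a + star b) ∧
      (∀ m < b, ¬ star a + star m ≤ star a + star b) at hr
    have hopt : ∀ c < a ^^^ b, (∃ m < a, star m + star b = star c) ∨
        ∃ m < b, star a + star m = star c := by
      intro c hc
      -- One of `c ^^^ b < a` and `c ^^^ a < b` holds; that smaller number is the nimber to move to.
      rcases Nat.lt_xor_cases hc with h | h
      · exact Or.inl ⟨_, h, by rw [ha _ h, Nat.xor_xor_cancel_right]⟩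
      · exact Or.inr ⟨_, h, by rw [hb _ h, Nat.xor_comm c, Nat.xor_xor_cancel_left]⟩
    apply le_antisymm
    · refine (val_add_star_le_iff (nimber a) (nimber (a ^^^ b)) b).2 ⟨?_, fun m hm h => ?_, ?_⟩
      · rw [forall_left_nimber a fun X => ¬ val (nimber (a ^^^ b)) ≤ val X + star b]
        intro m hm h
        change star _ ≤ star m + _ at h
        rw [ha m hm, star_le_star_iff] at h
        exact hm.ne' (Nat.xor_left_inj.1 h)
      · change star _ ≤ star a + _ at h
        rw [hb m hm, star_le_star_iff] at h
        exact hm.ne' (Nat.xor_right_inj.1 h)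
      · rw [forall_right_nimber _ fun X => ¬ val X ≤ val (nimber a) + star b]
        intro c hc h
        change star c ≤ star a + star b at h
        rcases hopt c hc with ⟨m, hm, h'⟩ | ⟨m, hm, h'⟩
        · exact hr.1 m hm (h' ▸ h)
        · exact hr.2 m hm (h' ▸ h)
    · refine (val_le_add_star_iff (nimber (a ^^^ b)) (nimber a) b).2 ⟨?_, ?_, fun m hm h => ?_⟩
      · rw [forall_left_nimber _ fun X => ¬ val (nimber a) + star b ≤ val X]
        intro c hc h
        change star a + star b ≤ star c at h
        rcases hopt c hc with ⟨m, hm, h'⟩ | ⟨m, hm, h'⟩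
        · exact hl.1 m hm (h' ▸ h)
        · exact hl.2 m hm (h' ▸ h)
      · rw [forall_right_nimber a fun X => ¬ val X + star b ≤ val (nimber (a ^^^ b))]
        intro m hm h
        change star m + _ ≤ star _ at h
        rw [ha m hm, star_le_star_iff] at h
        exact hm.ne (Nat.xor_left_inj.1 h)
      · change star a + _ ≤ star _ at h
        rw [hb m hm, star_le_star_iff] at h
        exact hm.ne (Nat.xor_right_inj.1 h)

theorem star_add_self (a : ℕ) : star a + star a = 0 := by
  rw [star_add_star, Nat.xor_self, star_zero]

theorem isCanonical_nimber (n : ℕ) : IsCanonical (nimber n) := by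
  induction n using Nat.strong_induction_on with
  | _ n ih =>
    have hinc : ∀ a b : ℕ, a ≠ b → ¬ nimber a ≤ nimber b := fun a b h h' =>
      h (star_le_star_iff.1 h')
    rw [IsCanonical]
    refine ⟨?_, ?_, ?_, ?_, (forall_left_nimber n IsCanonical).2 ih,
      (forall_right_nimber n IsCanonical).2 ih⟩
    · rw [nimber]
      exact fun i i' h => hinc _ _ (Fin.val_ne_of_ne h)
    · rw [nimber]
      exact fun i i' h => hinc _ _ (Fin.val_ne_of_ne h)
    · rw [forall_left_nimber n fun X => ∀ k, ¬ X.right k ≤ nimber n]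
      intro m hm
      rw [forall_right_nimber m fun X => ¬ X ≤ nimber n]
      exact fun l hl => hinc _ _ (by omega)
    · rw [forall_right_nimber n fun X => ∀ k, ¬ nimber n ≤ X.left k]
      intro m hm
      rw [forall_left_nimber m fun X => ¬ nimber n ≤ X]
      exact fun l hl => hinc _ _ (by omega)

theorem birthday_nimber (n : ℕ) : (nimber n).birthday = n := by
  rw [birthday_eq _ _ (isCanonical_nimber n) (Equal.refl _), height_nimber]


/-! ### Canonical forms and translation by nimbers -/

theorem IsCanonical.left {G : GameForm} (h : IsCanonical G) (i : Fin G.leftCard) :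
    IsCanonical (G.left i) := by
  rw [IsCanonical] at h
  exact h.2.2.2.2.1 i

theorem IsCanonical.right {G : GameForm} (h : IsCanonical G) (j : Fin G.rightCard) :
    IsCanonical (G.right j) := by
  rw [IsCanonical] at h
  exact h.2.2.2.2.2 j

theorem IsCanonical.left_eq_of_le {G : GameForm} (h : IsCanonical G) {i i' : Fin G.leftCard}
    (hle : val (G.left i) ≤ val (G.left i')) : i = i' := by
  rw [IsCanonical] at h
  by_contra hne
  exact h.1 i i' hne hle

theorem IsCanonical.right_eq_of_le {G : GameForm} (h : IsCanonical G) {j j' : Fin G.rightCard}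
    (hle : val (G.right j) ≤ val (G.right j')) : j = j' := by
  rw [IsCanonical] at h
  by_contra hne
  exact h.2.1 j j' hne hle

theorem IsCanonical.not_left_right_le {G : GameForm} (h : IsCanonical G) (i : Fin G.leftCard)
    (k : Fin (G.left i).rightCard) : ¬ val ((G.left i).right k) ≤ val G := by
  rw [IsCanonical] at h
  exact h.2.2.1 i k

theorem IsCanonical.not_le_right_left {G : GameForm} (h : IsCanonical G) (j : Fin G.rightCard)
    (k : Fin (G.right j).leftCard) : ¬ val G ≤ val ((G.right j).left k) := by
  rw [IsCanonical] at h
  exact h.2.2.2.1 j k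

theorem IsCanonical.height_eq {G H : GameForm} (hG : IsCanonical G) (hH : IsCanonical H)
    (h : val G = val H) : G.height = H.height := by
  have h := (val_eq_iff _ _).1 h
  exact le_antisymm (hG.height_le hH h) (hH.height_le hG h.symm)

theorem add_star_add_star (x : Value) (a b : ℕ) : x + star a + star b = x + star (a ^^^ b) := by
  rw [add_assoc, star_add_star]

theorem add_star_le_iff {x y : Value} {k : ℕ} : x + star k ≤ y ↔ x ≤ y + star k := by
  constructor
  · intro h
    have := add_le_add_left h (star k)
    rwa [add_assoc, star_add_self, add_zero] at this
  · intro h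
    have := add_le_add_left h (star k)
    rwa [add_assoc y, star_add_self, add_zero] at this

theorem add_star_le_add_star_iff {x : Value} {a b : ℕ} : x + star a ≤ x + star b ↔ a = b := by
  rw [add_le_add_iff_left, star_le_star_iff]

/-- Composition of inequalities up to nimbers. -/
theorem add_star_le_trans {x y z : Value} {a b c : ℕ} (h : x + star a ≤ y)
    (h' : y + star b ≤ z) (hc : a ^^^ b = c) : x + star c ≤ z := by
  rw [← hc, ← add_star_add_star]
  exact (add_le_add_left h _).trans h'

theorem add_star_le_self_iff {x : Value} {a : ℕ} : x + star a ≤ x ↔ a = 0 := by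
  conv_lhs => rw [← add_zero x, ← star_zero, add_assoc, star_zero, zero_add, ← star_zero]
  exact add_star_le_add_star_iff

/-- The case split behind every later argument: the obstruction is a left option of `X`, a right
option of `Y`, or a move of the nimber to a smaller one. -/
theorem exists_of_not_le_add_star {X Y : GameForm} {k : ℕ} (h : ¬ val X ≤ val Y + star k) :
    (∃ i, val Y + star k ≤ val (X.left i)) ∨ (∃ j, val (Y.right j) + star k ≤ val X) ∨
      ∃ m < k, val Y + star m ≤ val X := by
  by_contra! hc
  exact h ((val_le_add_star_iff X Y k).2 hc)

/-! ### Far nimbers: `k >>> n = 1` encodes `2^n ≤ k < 2^(n+1)` -/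

theorem shiftRight_eq_zero_iff_lt {m n : ℕ} : m >>> n = 0 ↔ m < 2 ^ n := by
  rw [Nat.shiftRight_eq_div_pow, Nat.div_eq_zero_iff]
  have := Nat.two_pow_pos n
  omega

theorem two_pow_le_of_shiftRight {k n : ℕ} (h : k >>> n = 1) : 2 ^ n ≤ k := by
  by_contra! hlt
  rw [shiftRight_eq_zero_iff_lt.2 hlt] at h
  exact zero_ne_one h

theorem two_pow_shiftRight_self (n : ℕ) : (2 ^ n) >>> n = 1 := by
  rw [Nat.shiftRight_eq_div_pow, Nat.div_self (Nat.two_pow_pos n)]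

/-- Canonical forms of small height (as measured by `M`) do not differ by a nimber of size
between `2 ^ n` and `2 ^ (n + 1)`. -/
def NoFarTranslate (n M : ℕ) : Prop :=
  ∀ X Y : GameForm, IsCanonical X → IsCanonical Y → 2 ^ X.height + 2 ^ Y.height < M →
    ∀ k, k >>> n = 1 → val X ≠ val Y + star k

theorem two_pow_height_left_lt (G : GameForm) (i : Fin G.leftCard) :
    2 ^ (G.left i).height < 2 ^ G.height :=
  Nat.pow_lt_pow_right one_lt_two (height_left_lt G i)

theorem two_pow_height_right_lt (G : GameForm) (j : Fin G.rightCard) :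
    2 ^ (G.right j).height < 2 ^ G.height :=
  Nat.pow_lt_pow_right one_lt_two (height_right_lt G j)

/-- All nimbers of size between `2 ^ n` and `2 ^ (n + 1)` compare in the same way with a
difference of forms of small height. -/
theorem NoFarTranslate.add_star_le {n M : ℕ} (hM : NoFarTranslate n M) {X Y : GameForm}
    (hX : IsCanonical X) (hY : IsCanonical Y) (hlt : 2 ^ X.height + 2 ^ Y.height < M)
    {k k' : ℕ} (hk : k >>> n = 1) (hk' : k' >>> n = 1) (h : val X + star k ≤ val Y) :
    val X + star k' ≤ val Y := by
  induction hs : X.height + Y.height using Nat.strong_induction_on generalizing X Y k k' with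
  | _ s ih =>
    subst hs
    rw [add_star_le_iff]
    by_contra hc
    rcases exists_of_not_le_add_star hc with ⟨i, hi⟩ | ⟨j, hj⟩ | ⟨m, hm, hm'⟩
    -- The induction hypothesis is used with the two forms, and `k` and `k'`, exchanged.
    · have h1 := height_left_lt X i
      have h2 := two_pow_height_left_lt X i
      have h3 := ih _ (by omega) hY (hX.left i) (by omega) hk' hk hi rfl
      exact not_val_le_left X i ((add_star_le_iff.1 h).trans h3)
    · have h1 := height_right_lt Y j
      have h2 := two_pow_height_right_lt Y j
      have h3 := ih _ (by omega) (hY.right j) hX (by omega) hk' hk hj rfl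
      exact not_val_right_le Y j ((add_star_le_iff.1 h3).trans h)
    -- The inequalities sandwich to `m = k`, so `Y` is a far translate of `X`, which `hM` forbids.
    · have h1 : val X + star k ≤ val X + star m := h.trans (add_star_le_iff.1 hm')
      obtain rfl := add_star_le_add_star_iff.1 h1
      exact hM Y X hY hX (by omega) k hk (le_antisymm (add_star_le_iff.1 hm') h)

/-! ### Structure of a minimal counterexample -/

section Minimal

variable {n M : ℕ} {X Y : GameForm}

/-- If `k` were larger than `2^n`, an option obstructing `X ≤ Y + *2^n` would form a pair of weight
below `M`. There `2^n` can be traded for `k`, so the option would obstruct the true equality as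
well. -/
theorem NoFarTranslate.eq_two_pow (hM : NoFarTranslate n M) (hX : IsCanonical X)
    (hY : IsCanonical Y) (hlt : 2 ^ X.height + 2 ^ Y.height ≤ M) {k : ℕ} (hk : k >>> n = 1)
    (h : val X = val Y + star k) : k = 2 ^ n := by
  by_contra hne
  have hn := two_pow_shiftRight_self n
  have hc : ¬ val X ≤ val Y + star (2 ^ n) := by
    rw [h, add_star_le_add_star_iff]
    exact hne
  rcases exists_of_not_le_add_star hc with ⟨i, hi⟩ | ⟨j, hj⟩ | ⟨m, hm, hm'⟩
  · have h2 := two_pow_height_left_lt X i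
    have h3 := hM.add_star_le hY (hX.left i) (by omega) hn hk hi
    exact not_val_le_left X i (h ▸ h3)
  · have h2 := two_pow_height_right_lt Y j
    have h3 := hM.add_star_le (hY.right j) hX (by omega) hn hk hj
    rw [h, add_le_add_iff_right] at h3
    exact not_val_right_le Y j h3
  · rw [h, add_star_le_add_star_iff] at hm'
    have := two_pow_le_of_shiftRight hk
    omega

/-- If `X = Y + *2ⁿ`, then a left option of `X` above `Y + *m` with `m < 2ⁿ` equals `Y + *m`. -/
theorem NoFarTranslate.eq_of_add_star_le_left (hM : NoFarTranslate n M) (hX : IsCanonical X)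
    (hY : IsCanonical Y) (hXY : 2 ^ X.height + 2 ^ Y.height ≤ M)
    (hn0 : n ≠ 0) (h : val X = val Y + star (2 ^ n)) {m : ℕ} (hm : m >>> n = 0)
    (i : Fin X.leftCard) (hi : val Y + star m ≤ val (X.left i)) :
    val (X.left i) = val Y + star m := by
  have hn := two_pow_shiftRight_self n
  -- Two different near values, 0 and 1, are needed to reach contradictions below; this is where `n
  -- ≠ 0` enters.
  have hpos : ∃ a, a ≠ 0 ∧ a >>> n = 0 := ⟨1, one_ne_zero, by
    rw [shiftRight_eq_zero_iff_lt]; exact Nat.one_lt_two_pow hn0⟩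
  have hX2 := fun i => two_pow_height_left_lt X i
  have hY2 := fun i => two_pow_height_left_lt Y i
  have hXl : ∀ i, ¬ val Y ≤ val (X.left i) + star (2 ^ n) := fun i h' =>
    not_val_le_left X i (h ▸ add_star_le_iff.2 h')
  rcases exists_of_not_le_add_star (hXl i) with ⟨a, ha⟩ | ⟨b, hb⟩ | ⟨m', hm', hm''⟩
  · have hi2 := hX2 i
    have ha2 := hY2 a
    -- The pair of options has smaller weight, so one far comparison gives all of them. Near xor far
    -- is far, and far xor far is near.
    have hall : ∀ k, k >>> n = 1 → val (X.left i) + star k ≤ val (Y.left a) := fun k hk =>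
      hM.add_star_le (hX.left i) (hY.left a) (by omega) hn hk ha
    have hall' : ∀ k, k >>> n = 1 → val Y + star k ≤ val (Y.left a) := fun k hk =>
      add_star_le_trans hi (hall (m ^^^ k) (by rw [Nat.shiftRight_xor_distrib, hm, hk]; rfl))
        (Nat.xor_xor_cancel_left _ _)
    have hc : ¬ val X ≤ val (Y.left a) + star (2 ^ n) := fun h' => by
      rw [h, add_le_add_iff_right] at h'
      exact not_val_le_left Y a h'
    rcases exists_of_not_le_add_star hc with ⟨i', hi'⟩ | ⟨b, hb⟩ | ⟨m', hm', hm''⟩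
    · obtain ⟨c, hc0, hcn⟩ := hpos
      have hi'2 := hX2 i'
      -- With `d = 0` one left option of `X` dominates another, so they coincide; then `d = 1` makes
      -- a value comparable with its translate by `*1`.
      have h1 : ∀ d, d >>> n = 0 → val (X.left i) + star d ≤ val (X.left i') := fun d hd =>
        add_star_le_trans (hall (2 ^ n ^^^ d) (by rw [Nat.shiftRight_xor_distrib, hn, hd]; rfl))
          hi' (by rw [Nat.xor_comm (2 ^ n), Nat.xor_xor_cancel_right])
      have h0 := h1 0 (Nat.zero_shiftRight n)
      rw [star_zero, add_zero] at h0
      obtain rfl := hX.left_eq_of_le h0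
      exact absurd (add_star_le_self_iff.1 (h1 c hcn)) hc0
    · rw [h, add_le_add_iff_right] at hb
      exact absurd hb (hY.not_left_right_le a b)
    · obtain ⟨c, hc0, hcn⟩ := hpos
      have hm0 := shiftRight_eq_zero_iff_lt.2 hm'
      have h1 : ∀ d, d >>> n = 0 → m' = d := fun d hd => by
        have h2 := add_star_le_trans (hall' (2 ^ n ^^^ d)
          (by rw [Nat.shiftRight_xor_distrib, hn, hd]; rfl)) hm'' rfl
        rw [h, add_star_le_add_star_iff] at h2
        have h3 : (2 ^ n ^^^ (d ^^^ m')) = 2 ^ n ^^^ 0 := by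
          rw [← Nat.xor_assoc, h2, Nat.xor_zero]
        exact (Nat.xor_eq_zero_iff.1 (Nat.xor_right_inj.1 h3)).symm
      exact absurd ((h1 c hcn).symm.trans (h1 0 (Nat.zero_shiftRight n))) hc0
  -- Here `X.left i` would be reversible.
  · exact absurd (h ▸ add_star_le_iff.1 hb) (hX.not_left_right_le i b)
  · have h1 := add_star_le_iff.1 hm''
    obtain rfl := add_star_le_add_star_iff.1 (hi.trans h1)
    exact le_antisymm h1 hi

/-- If `X = Y + *2ⁿ`, then a right option of `Y` below `X + *m` with `m < 2ⁿ` equals `X + *m`. -/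
theorem NoFarTranslate.eq_of_right_add_star_le (hM : NoFarTranslate n M) (hX : IsCanonical X)
    (hY : IsCanonical Y) (hXY : 2 ^ X.height + 2 ^ Y.height ≤ M)
    (hn0 : n ≠ 0) (h : val X = val Y + star (2 ^ n)) {m : ℕ} (hm : m >>> n = 0)
    (j : Fin Y.rightCard) (hj : val (Y.right j) + star m ≤ val X) :
    val (Y.right j) = val X + star m := by
  have hn := two_pow_shiftRight_self n
  have hpos : ∃ a, a ≠ 0 ∧ a >>> n = 0 := ⟨1, one_ne_zero, by
    rw [shiftRight_eq_zero_iff_lt]; exact Nat.one_lt_two_pow hn0⟩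
  have hX2 := fun i => two_pow_height_right_lt X i
  have hY2 := fun i => two_pow_height_right_lt Y i
  have h' : val X + star (2 ^ n) = val Y := by
    rw [h, add_star_add_star, Nat.xor_self, star_zero, add_zero]
  have hc : ¬ val (Y.right j) ≤ val X + star (2 ^ n) := h' ▸ not_val_right_le Y j
  rcases exists_of_not_le_add_star hc with ⟨a, ha⟩ | ⟨b, hb⟩ | ⟨m', hm', hm''⟩
  · exact absurd (h' ▸ ha) (hY.not_le_right_left j a)
  · have hj2 := hY2 j
    have hb2 := hX2 b
    -- As on the left side: all far comparisons hold at once, and the remaining cases give a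
    -- reversible option, a dominated option, or one `m' ^^^ m` equal to every near `d`.
    have hall : ∀ k, k >>> n = 1 → val (X.right b) + star k ≤ val (Y.right j) := fun k hk =>
      hM.add_star_le (hX.right b) (hY.right j) (by omega) hn hk hb
    have hc' : ¬ val (X.right b) ≤ val Y + star (2 ^ n) := h ▸ not_val_right_le X b
    rcases exists_of_not_le_add_star hc' with ⟨a, ha⟩ | ⟨j', hj'⟩ | ⟨m', hm', hm''⟩
    · exact absurd (h ▸ ha) (hX.not_le_right_left b a)
    · obtain ⟨c, hc0, hcn⟩ := hpos
      have h1 : ∀ d, d >>> n = 0 → val (Y.right j') + star d ≤ val (Y.right j) := fun d hd =>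
        add_star_le_trans hj' (hall (2 ^ n ^^^ d) (by rw [Nat.shiftRight_xor_distrib, hn, hd]; rfl))
          (Nat.xor_xor_cancel_left _ _)
      have h0 := h1 0 (Nat.zero_shiftRight n)
      rw [star_zero, add_zero] at h0
      obtain rfl := hY.right_eq_of_le h0
      exact absurd (add_star_le_self_iff.1 (h1 c hcn)) hc0
    · obtain ⟨c, hc0, hcn⟩ := hpos
      have h1 : ∀ d, d >>> n = 0 → m' ^^^ m = d := fun d hd => by
        have h2 := add_star_le_trans (add_star_le_trans hm'' (hall (2 ^ n ^^^ d)
          (by rw [Nat.shiftRight_xor_distrib, hn, hd]; rfl)) rfl) hj rfl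
        rw [h, add_star_le_add_star_iff] at h2
        have h3 : (2 ^ n ^^^ (d ^^^ (m' ^^^ m))) = 2 ^ n ^^^ 0 := by
          rw [Nat.xor_zero]
          conv_rhs => rw [← h2]
          ac_rfl
        exact (Nat.xor_eq_zero_iff.1 (Nat.xor_right_inj.1 h3)).symm
      exact absurd ((h1 c hcn).symm.trans (h1 0 (Nat.zero_shiftRight n))) hc0
  · have h1 := add_star_le_iff.1 hj
    obtain rfl := add_star_le_add_star_iff.1 (hm''.trans h1)
    exact le_antisymm h1 hm''

/-- Distinct right options of `Y` that are far nimber translates of `Y` have distinct heights. -/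
theorem NoFarTranslate.height_right_ne (hM : NoFarTranslate n M) (hY : IsCanonical Y)
    (hYM : 2 ^ Y.height < M) {j j' : Fin Y.rightCard} {k k' : ℕ} (hk : k >>> n = 1)
    (hk' : k' >>> n = 1) (hkk : k' < k) (h : val (Y.right j) = val Y + star k)
    (h' : val (Y.right j') = val Y + star k') : (Y.right j).height ≠ (Y.right j').height := by
  intro heq
  -- Any two options of `Y` together weigh at most `2 ^ Y.height < M`, so far nimbers are
  -- interchangeable between them.
  have hY2 : ∀ b, 2 * 2 ^ (Y.right b).height ≤ 2 ^ Y.height := fun b => by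
    rw [← Nat.pow_succ']
    exact Nat.pow_le_pow_right two_pos (height_right_lt Y b)
  have hj2 := hY2 j
  have hc : ¬ val (Y.right j) ≤ val Y + star k' := by
    rw [h, add_star_le_add_star_iff]
    exact hkk.ne'
  rcases exists_of_not_le_add_star hc with ⟨i, hi⟩ | ⟨b, hb⟩ | ⟨m, hm, hm'⟩
  · have hi2 := two_pow_height_left_lt (Y.right j) i
    have hc' : ¬ val Y ≤ val ((Y.right j).left i) + star k := fun hle =>
      not_val_le_left (Y.right j) i (h ▸ add_star_le_iff.2 hle)
    rcases exists_of_not_le_add_star hc' with ⟨a, ha⟩ | ⟨b, hb⟩ | ⟨m, hm, hm'⟩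
    · have ha2 : 2 * 2 ^ (Y.left a).height ≤ 2 ^ Y.height := by
        rw [← Nat.pow_succ']
        exact Nat.pow_le_pow_right two_pos (height_left_lt Y a)
      have h3 := hM.add_star_le ((hY.right j).left i) (hY.left a) (by omega) hk hk' ha
      have h4 := add_star_le_trans hi h3 (Nat.xor_self k')
      rw [star_zero, add_zero] at h4
      exact not_val_le_left Y a h4
    · exact (hY.right j).not_left_right_le i b (h ▸ add_star_le_iff.1 hb)
    -- Here `(Y.right j).left i` is squeezed to the value of `Y.right j'`. Equal canonical forms
    -- have equal heights, so `Y.right j'` is strictly lower than `Y.right j`.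
    · have h1 := add_star_le_iff.1 hm'
      obtain rfl := add_star_le_add_star_iff.1 (hi.trans h1)
      have h2 := ((hY.right j).left i).height_eq (hY.right j') ((le_antisymm h1 hi).trans h'.symm)
      have h3 := height_left_lt (Y.right j) i
      omega
  · have hb2 := hY2 b
    have h3 := hM.add_star_le (hY.right b) (hY.right j) (by omega) hk' hk hb
    rw [h, add_le_add_iff_right] at h3
    exact not_val_right_le Y b h3
  · rw [h, add_star_le_add_star_iff] at hm'
    omega

/-- The failure of `X ≤ Y + *m` for each `m < 2^n` must be witnessed by a right option of `Y`; this
gives `2^n` options of distinct heights, more than `Y` has room for. -/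
theorem NoFarTranslate.ne_of_height_le (hM : NoFarTranslate n M) (hX : IsCanonical X)
    (hY : IsCanonical Y) (hXY : 2 ^ X.height + 2 ^ Y.height = M) (hMn : M ≤ 2 ^ 2 ^ n)
    (hle : X.height ≤ Y.height) {k : ℕ} (hk : k >>> n = 1) : val X ≠ val Y + star k := by
  intro h
  obtain rfl := hM.eq_two_pow hX hY hXY.le hk h
  have hXpos := Nat.two_pow_pos X.height
  have hYpos := Nat.two_pow_pos Y.height
  have h' : val X + star (2 ^ n) = val Y := by
    rw [h, add_star_add_star, Nat.xor_self, star_zero, add_zero]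
  have hopt : ∀ m < 2 ^ n, ∃ j, val (Y.right j) = val Y + star (2 ^ n ^^^ m) := by
    intro m hm
    have hm0 := shiftRight_eq_zero_iff_lt.2 hm
    have hc : ¬ val X ≤ val Y + star m := by
      rw [h, add_star_le_add_star_iff]
      exact hm.ne'
    rcases exists_of_not_le_add_star hc with ⟨i, hi⟩ | ⟨j, hj⟩ | ⟨m', hm', hm''⟩
    · have hi2 := two_pow_height_left_lt X i
      -- For `n = 0` the bound is `M ≤ 2`, so both forms have height 0 and no options.
      have hn0 : n ≠ 0 := by
        rintro rfl
        have := Nat.two_pow_pos (X.left i).height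
        norm_num at hMn
        omega
      have heq := hM.eq_of_add_star_le_left hX hY hXY.le hn0 h hm0 i hi
      rw [← h', add_star_add_star] at heq
      -- Since `X` is no taller than `Y`, the pair of `X` and its option weighs less than `M`, so
      -- the option cannot be a far translate of `X`.
      have hle2 := Nat.pow_le_pow_right two_pos hle
      exact absurd heq (hM _ _ (hX.left i) hX (by omega) _
        (by rw [Nat.shiftRight_xor_distrib, hk, hm0]; rfl))
    · have hj2 := two_pow_height_right_lt Y j
      have hn0 : n ≠ 0 := by
        rintro rfl
        have := Nat.two_pow_pos (Y.right j).height
        norm_num at hMn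
        omega
      refine ⟨j, ?_⟩
      rw [hM.eq_of_right_add_star_le hX hY hXY.le hn0 h hm0 j hj, h, add_star_add_star]
    · rw [h, add_star_le_add_star_iff] at hm''
      omega
  -- The weight of `X` is positive, so `2 ^ Y.height < M ≤ 2 ^ 2 ^ n`.
  have hYn : Y.height < 2 ^ n := (Nat.pow_lt_pow_iff_right one_lt_two).1 (by omega)
  choose f hf using fun m : Fin (2 ^ n) => hopt m.1 m.2
  have hfar : ∀ m : Fin (2 ^ n), (2 ^ n ^^^ m.1) >>> n = 1 := fun m => by
    rw [Nat.shiftRight_xor_distrib, hk, shiftRight_eq_zero_iff_lt.2 m.2]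
    rfl
  obtain ⟨a, b, hab, heq⟩ := Fintype.exists_ne_map_eq_of_card_lt
    (fun m : Fin (2 ^ n) => (⟨(Y.right (f m)).height, height_right_lt Y _⟩ : Fin Y.height))
    (by simpa using hYn)
  have heq := Fin.mk.inj heq
  have hne : (2 ^ n ^^^ a.1) ≠ 2 ^ n ^^^ b.1 := fun hh => hab (Fin.ext (Nat.xor_right_inj.1 hh))
  rcases hne.lt_or_gt with hlt | hlt
  · exact hM.height_right_ne hY (by omega) (hfar b) (hfar a) hlt (hf b) (hf a) heq.symm
  · exact hM.height_right_ne hY (by omega) (hfar a) (hfar b) hlt (hf a) (hf b) heq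

end Minimal

/-- Induction on `M`. In the new case of weight exactly `M`, the relation `X = Y + *k` is symmetric
because `*k + *k = 0`, so the taller form may be taken as `Y`. The bound on `M` admits all pairs of
heights below `2^n`. -/
theorem noFarTranslate (n M : ℕ) (hMn : M ≤ 2 ^ 2 ^ n + 1) : NoFarTranslate n M := by
  induction M with
  | zero => exact fun X Y _ _ h => absurd h (Nat.not_lt_zero _)
  | succ M ih =>
    have hM := ih (by omega)
    intro X Y hX hY hlt k hk h
    rcases (Nat.lt_succ_iff.1 hlt).lt_or_eq with hlt | heq
    · exact hM X Y hX hY hlt k hk h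
    · rcases le_total X.height Y.height with hle | hle
      · exact hM.ne_of_height_le hX hY heq (by omega) hle hk h
      · refine hM.ne_of_height_le hY hX (by omega) (by omega) hle hk ?_
        rw [h, add_star_add_star, Nat.xor_self, star_zero, add_zero]

/-! ### Negation of canonical forms and the two directions -/

theorem two_pow_height_canonicalForm_le {G : GameForm} {N : ℕ} (h : G.birthday < N) :
    2 * 2 ^ G.canonicalForm.height ≤ 2 ^ N := by
  rw [← Nat.pow_succ']
  exact Nat.pow_le_pow_right two_pos h

theorem val_canonicalForm (G : GameForm) : val G.canonicalForm = val G :=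
  (val_eq_iff _ _).2 (canonicalForm_spec G).2

theorem val_neg (G : GameForm) : val (-G) = -val G := rfl

theorem height_neg (G : GameForm) : (-G).height = G.height := by
  induction hn : G.height using Nat.strong_induction_on generalizing G with
  | _ n ih =>
    subst hn
    refine eq_of_forall_ge_iff fun b => ?_
    rw [height_le_iff, height_le_iff, forall_left_neg G fun X => X.height < b,
      forall_right_neg G fun X => X.height < b, and_comm]
    refine and_congr (forall_congr' fun i => ?_) (forall_congr' fun j => ?_)
    · rw [ih _ (height_left_lt G i) _ rfl]
    · rw [ih _ (height_right_lt G j) _ rfl]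

theorem neg_le_neg_iff' (G H : GameForm) : -G ≤ -H ↔ H ≤ G := by
  rw [← val_le_iff, val_neg, val_neg, neg_le_neg_iff, val_le_iff]

theorem forall_ne_left_neg (G : GameForm) (P : GameForm → GameForm → Prop) :
    (∀ i i', i ≠ i' → P ((-G).left i) ((-G).left i')) ↔
      ∀ j j', j ≠ j' → P (-G.right j) (-G.right j') := by
  cases G
  rfl

theorem forall_ne_right_neg (G : GameForm) (P : GameForm → GameForm → Prop) :
    (∀ j j', j ≠ j' → P ((-G).right j) ((-G).right j')) ↔
      ∀ i i', i ≠ i' → P (-G.left i) (-G.left i') := by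
  cases G
  rfl

/-- Allows a summand to be moved across the equation `*2^n = H + J` without changing the height of
its canonical form. -/
theorem IsCanonical.neg {G : GameForm} (hG : IsCanonical G) : IsCanonical (-G) := by
  induction hn : G.height using Nat.strong_induction_on generalizing G with
  | _ n ih =>
    subst hn
    have hl := fun i => ih _ (height_left_lt G i) (hG.left i) rfl
    have hr := fun j => ih _ (height_right_lt G j) (hG.right j) rfl
    rw [IsCanonical] at hG ⊢
    rw [forall_ne_left_neg G fun A B => ¬ A ≤ B, forall_ne_right_neg G fun A B => ¬ A ≤ B,
      forall_left_neg G fun A => ∀ k, ¬ A.right k ≤ -G,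
      forall_right_neg G fun A => ∀ k, ¬ -G ≤ A.left k,
      forall_left_neg G, forall_right_neg G]
    refine ⟨fun j j' h => ?_, fun i i' h => ?_, fun j => ?_, fun i => ?_, hr, hl⟩
    · rw [neg_le_neg_iff']
      exact hG.2.1 j' j h.symm
    · rw [neg_le_neg_iff']
      exact hG.1 i' i h.symm
    · rw [forall_right_neg _ fun A => ¬ A ≤ -G]
      intro k
      rw [neg_le_neg_iff']
      exact hG.2.2.2.1 j k
    · rw [forall_left_neg _ fun A => ¬ -G ≤ A]
      intro k
      rw [neg_le_neg_iff']
      exact hG.2.2.1 i k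

theorem indecomposable_nimber_two_pow (n : ℕ) : Indecomposable (nimber (2 ^ n)) := by
  rintro ⟨H, J, hH, hJ, h⟩
  rw [birthday_nimber] at hH hJ
  have hH' := two_pow_height_canonicalForm_le hH
  have hJ' := two_pow_height_canonicalForm_le hJ
  rw [← height_neg] at hJ'
  refine noFarTranslate n _ le_rfl H.canonicalForm (-J.canonicalForm) (canonicalForm_spec H).1
    (canonicalForm_spec J).1.neg (by omega) _ (two_pow_shiftRight_self n) ?_
  have h2 : star (2 ^ n) = val H + val J := (val_eq_iff _ _).2 h
  rw [val_neg, val_canonicalForm, val_canonicalForm, h2]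
  abel

theorem decomposable_nimber {k : ℕ} (hk : k ≠ 0) (h : ∀ n, k ≠ 2 ^ n) :
    Decomposable (nimber k) := by
  have h1 := Nat.pow_log_le_self 2 hk
  have h2 := Nat.lt_pow_succ_log_self one_lt_two k
  have h3 := h (Nat.log 2 k)
  rw [Nat.pow_succ] at h2
  refine ⟨nimber (2 ^ Nat.log 2 k), nimber (k - 2 ^ Nat.log 2 k), ?_, ?_, ?_⟩
  · simp only [birthday_nimber]
    omega
  · simp only [birthday_nimber]
    have := Nat.two_pow_pos (Nat.log 2 k)
    omega
  · refine (val_eq_iff _ _).1 ?_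
    change star k = star _ + star _
    have hlt : k - 2 ^ Nat.log 2 k < 2 ^ Nat.log 2 k := by omega
    have hx : (2 ^ Nat.log 2 k ^^^ (k - 2 ^ Nat.log 2 k)) = k := by
      generalize Nat.log 2 k = n at *
      generalize hb : k - 2 ^ n = b at *
      obtain rfl : k = 2 ^ n + b := by omega
      -- As `b < 2^n`, xor and sum agree because their quotients and remainders modulo `2^n` agree.
      have hd : (2 ^ n ^^^ b) / 2 ^ n = (2 ^ n + b) / 2 ^ n := by
        rw [Nat.xor_div_two_pow, Nat.div_self (Nat.two_pow_pos n), Nat.div_eq_of_lt hlt,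
          Nat.add_div_left _ (Nat.two_pow_pos n), Nat.div_eq_of_lt hlt]
        rfl
      have hm : (2 ^ n ^^^ b) % 2 ^ n = (2 ^ n + b) % 2 ^ n := by
        rw [Nat.xor_mod_two_pow, Nat.mod_self, Nat.add_mod_left, Nat.zero_xor]
      rw [← Nat.div_add_mod (2 ^ n ^^^ b) (2 ^ n), hd, hm, Nat.div_add_mod]
    rw [star_add_star, hx]

end GameForm

theorem mainTheorem1 (k : ℕ) (hk : k ≠ 0) :
    GameForm.Indecomposable (GameForm.nimber k) ↔ ∃ n : ℕ, k = 2 ^ n := by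
  constructor
  · intro h
    by_contra! hc
    exact h (GameForm.decomposable_nimber hk hc)
  · rintro ⟨n, rfl⟩
    exact GameForm.indecomposable_nimber_two_pow n
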